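/- All rings are commutative with unit. For a ring $A$ and an $A$-module $M$, let $\mathrm{Supp}_A(M)=\{P\in\mathrm{Spec}(A)\mid M_P\neq 0\}$, and let the Oda ideal $\mathcal O_A(M)$ be the set of all $a\in A$ such that $M_a=0$, where $M_a$ is the localization of $M$ at $\{a^n\mid n\in\mathbb N\}$. "Closed" refers to the Zariski topology. A ring morphism $R\to T$ is called absolutely flat if both $R\to T$ and the co-diagonal (multiplication) morphism $T\otimes_RT\to T$ are flat. Proposition. Let $g:R\to T$ be a flat ring morphism, ${}^ag:\mathrm{Spec}(T)\to\mathrm{Spec}(R)$ its spectral map, and let $E$ be an $R$-module. (1) $({}^ag)^{-1}(\mathrm{Supp}_R(E))=\mathrm{Supp}_T(E\otimes_RT)$. (2) If $\mathrm{Supp}_R(E)$ is closed, then $\mathrm{Supp}_T(E\otimes_RT)$ is closed and $\mathcal O_T(E\otimes_RT)=\sqrt{\mathcal O_R(E)T}$. (3) If $\mathrm{Supp}_R(E)$ is closed and $g$ is absolutely flat, then $\mathcal O_T(E\otimes_RT)=\mathcal O_R(E)T$. (4) If $g$ is moreover an epimorphism of commutative rings, then $g$ is absolutely flat; hence, if in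 addition $\mathrm{Supp}_R(E)$ is closed, then $\mathcal O_T(E\otimes_RT)=\mathcal O_R(E)T$. -/

import Mathlib

open scoped TensorProduct

universe u v

/-- The Oda ideal `𝒪_R(E)` of an `R`-module `E`: the set of all `a : R` such that `E_a = 0`,
where `E_a` is the localization of `E` at the multiplicative set of powers of `a`. -/
def odaIdeal (R : Type u) [CommRing R] (E : Type v) [AddCommGroup E] [Module R E] : Ideal R where
  carrier := {a | Subsingleton (LocalizedModule (Submonoid.powers a) E)}
  zero_mem' := LocalizedModule.subsingleton (Submonoid.mem_powers 0)
  add_mem' := by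
    intro a b ha hb
    simp only [Set.mem_ofPred_eq, LocalizedModule.subsingleton_iff] at *
    intro x
    obtain ⟨_, ⟨m, rfl⟩, hm⟩ := ha x
    obtain ⟨_, ⟨n, rfl⟩, hn⟩ := hb x
    simp only at hm hn
    refine ⟨_, ⟨m + n, rfl⟩, ?_⟩
    have h : (a + b) ^ (m + n) ∈ (Submodule.span R {x}).annihilator := by
      exact Ideal.add_pow_mem_of_pow_mem_of_le (m := m) (n := n) _
        ((Submodule.mem_annihilator_span_singleton x _).2 hm)
        ((Submodule.mem_annihilator_span_singleton x _).2 hn) (by lia)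
    rwa [Submodule.mem_annihilator_span_singleton] at h
  smul_mem' := by
    intro c a ha
    simp only [Set.mem_ofPred_eq, LocalizedModule.subsingleton_iff] at *
    intro x
    obtain ⟨_, ⟨n, rfl⟩, hn⟩ := ha x
    simp only at hn
    exact ⟨_, ⟨n, rfl⟩, by simp only [smul_eq_mul, mul_pow, mul_smul, hn, smul_zero]⟩

/-- A ring morphism `f : R → T` is an epimorphism of commutative rings: it is right-cancellable
among morphisms to commutative rings. Test rings in the universe of `T` suffice, since it contains
`T ⊗[R] T`: the notion does not change if other universes are allowed too. -/
def IsCommRingEpi {R : Type u} {T : Type v} [CommRing R] [CommRing T] (f : R →+* T) : Prop :=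
  ∀ (S : Type v) [CommRing S] (p q : T →+* S),
    p.comp f = q.comp f → p = q

/-! Flatness extends annihilators of elements, `Ann(1 ⊗ m) = Ann(m)T`, which yields the support
formula. The Oda ideal is the vanishing ideal of the support, so for closed support the radical
formula is the Nullstellensatz for `Spec`. Dropping the radical requires weakly étale base change to
preserve radical ideals (`Algebra.WeaklyEtale.isRadical_map`): `R/I` embeds in a product `A` of
fields, `T/IT` embeds in `A ⊗ T` by flatness, and `A ⊗ T` is reduced because it is weakly étale over
a von Neumann regular ring. -/

section Annihilator

variable {R T E : Type*} [CommRing R] [CommRing T] [Algebra R T]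
    [AddCommGroup E] [Module R E]

/-- The annihilator of `1 ⊗ₜ m` in a flat base change is the extension of the annihilator of `m`. -/
lemma annihilator_span_one_tmul [Module.Flat R T] (m : E) :
    (Submodule.span T {(1 : T) ⊗ₜ[R] m}).annihilator =
      (Submodule.span R {m}).annihilator.map (algebraMap R T) := by
  set J := (Submodule.span R {m}).annihilator with hJ
  apply le_antisymm
  · intro t ht
    rw [Submodule.mem_annihilator_span_singleton, TensorProduct.smul_tmul', smul_eq_mul,
      mul_one] at ht
    have hex : Function.Exact J.subtype (LinearMap.toSpanSingleton R E m) := by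
      intro x
      rw [LinearMap.toSpanSingleton_apply, ← Submodule.mem_annihilator_span_singleton]
      simp [← hJ]
    -- Tensor `J → R → E` with `T`: since `t ⊗ m = 0`, the element `t ⊗ 1` comes from `T ⊗ J`, whose
    -- image in `T` lies in `JT`.
    obtain ⟨y, hy⟩ := (Module.Flat.lTensor_exact T hex (t ⊗ₜ[R] (1 : R))).1 (by simpa using ht)
    have key : ∀ y : T ⊗[R] J,
        TensorProduct.rid R T (J.subtype.lTensor T y) ∈ J.map (algebraMap R T) := by
      intro y
      induction y with
      | zero => simp
      | tmul u v =>
        simp only [LinearMap.lTensor_tmul, Submodule.subtype_apply, TensorProduct.rid_tmul,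
          Algebra.smul_def]
        exact Ideal.mul_mem_right _ _ (Ideal.mem_map_of_mem _ v.2)
      | add u v hu hv => simpa only [map_add] using add_mem hu hv
    simpa [hy] using key y
  · rw [Ideal.map_le_iff_le_comap]
    intro a ha
    rw [hJ, Submodule.mem_annihilator_span_singleton] at ha
    rw [Ideal.mem_comap, Submodule.mem_annihilator_span_singleton, algebraMap_smul,
      ← TensorProduct.tmul_smul, ha, TensorProduct.tmul_zero]

-- A prime is in the support iff it contains the annihilator of some generator; the `1 ⊗ m`
-- generate, and `Ann(m)T ⊆ p` iff `Ann(m)` lies in the contraction of `p`.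
variable (R T E) in
lemma comap_preimage_support_eq_support_tensorProduct [Module.Flat R T] :
    PrimeSpectrum.comap (algebraMap R T) ⁻¹' Module.support R E =
      Module.support T (T ⊗[R] E) := by
  ext p
  have hs : Submodule.span T (Set.range fun m : E ↦ (1 : T) ⊗ₜ[R] m) = ⊤ := by
    rw [eq_top_iff]
    rintro x -
    induction x with
    | zero => exact zero_mem _
    | tmul t m =>
      have := Submodule.smul_mem _ t (Submodule.subset_span (R := T)
        (Set.mem_range_self (f := fun m : E ↦ (1 : T) ⊗ₜ[R] m) m))
      simpa [TensorProduct.smul_tmul'] using this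
    | add u v hu hv => exact add_mem hu hv
  simp only [Set.mem_preimage, Module.mem_support_iff_of_span_eq_top hs,
    Module.mem_support_iff_exists_annihilator, Set.exists_range_iff, annihilator_span_one_tmul,
    Ideal.map_le_iff_le_comap, PrimeSpectrum.comap_asIdeal]

end Annihilator

section Oda

variable {R E : Type*} [CommRing R] [AddCommGroup E] [Module R E]

-- `E_a` vanishes iff the support lies in `V(a)`.
variable (R E) in
lemma odaIdeal_eq_vanishingIdeal :
    odaIdeal R E = PrimeSpectrum.vanishingIdeal (Module.support R E) := by
  ext a
  change Subsingleton (LocalizedModule.Away a E) ↔ _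
  rw [LocalizedModule.subsingleton_iff_support_subset, PrimeSpectrum.mem_vanishingIdeal]
  simp [Set.subset_def]

lemma zeroLocus_odaIdeal (h : IsClosed (Module.support R E)) :
    PrimeSpectrum.zeroLocus (odaIdeal R E : Set R) = Module.support R E := by
  rw [odaIdeal_eq_vanishingIdeal, PrimeSpectrum.zeroLocus_vanishingIdeal_eq_closure, h.closure_eq]

variable (R E) in
lemma isRadical_odaIdeal : (odaIdeal R E).IsRadical := by
  rw [odaIdeal_eq_vanishingIdeal]
  exact PrimeSpectrum.isRadical_vanishingIdeal _

lemma odaIdeal_tensorProduct_eq_radical {T : Type*} [CommRing T] [Algebra R T] [Module.Flat R T]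
    (h : IsClosed (Module.support R E)) :
    odaIdeal T (T ⊗[R] E) = ((odaIdeal R E).map (algebraMap R T)).radical := by
  rw [odaIdeal_eq_vanishingIdeal T, ← comap_preimage_support_eq_support_tensorProduct,
    ← zeroLocus_odaIdeal h, PrimeSpectrum.preimage_comap_zeroLocus,
    ← PrimeSpectrum.vanishingIdeal_zeroLocus_eq_radical, Ideal.map, PrimeSpectrum.zeroLocus_span]

end Oda

section VonNeumannRegular

variable {A : Type*} [CommRing A]

/-- Over a von Neumann regular ring every module is flat. -/
lemma flat_of_forall_exists_mul_mul_eq (hA : ∀ a : A, ∃ x, a * a * x = a)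
    (M : Type*) [AddCommGroup M] [Module A M] : Module.Flat A M := by
  rw [Module.Flat.iff_rTensor_injective]
  intro I hI
  have hid : IsIdempotentElem I := by
    refine le_antisymm Ideal.mul_le_left fun a ha ↦ ?_
    obtain ⟨x, hx⟩ := hA a
    rw [← hx]
    exact Ideal.mul_mem_right _ _ (Ideal.mul_mem_mul ha ha)
  obtain ⟨e, he, rfl⟩ := (Ideal.isIdempotentElem_iff_of_fg I hI).1 hid
  -- Multiplication by `e` splits the inclusion of the ideal, which therefore stays injective after
  -- tensoring.
  let r : A →ₗ[A] (Submodule.span A {e} : Submodule A A) :=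
    LinearMap.toSpanSingleton A _ ⟨e, Submodule.mem_span_singleton_self e⟩
  have hr : r ∘ₗ (Submodule.span A {e}).subtype = LinearMap.id := by
    ext ⟨x, hx⟩
    obtain ⟨y, rfl⟩ := Submodule.mem_span_singleton.1 hx
    simp [r, mul_assoc, he.eq]
  refine Function.LeftInverse.injective (g := r.rTensor M) fun x ↦ ?_
  rw [← LinearMap.comp_apply, ← LinearMap.rTensor_comp, hr, LinearMap.rTensor_id,
    LinearMap.id_apply]

/-- A weakly étale algebra over a von Neumann regular ring is von Neumann regular. -/
lemma Algebra.WeaklyEtale.mem_sq_span_singleton (hA : ∀ a : A, ∃ x, a * a * x = a)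
    {B : Type*} [CommRing B] [Algebra A B] [Algebra.WeaklyEtale A B] (b : B) :
    b ∈ (Ideal.span {b}) ^ 2 := by
  let μ := Algebra.TensorProduct.lmul' A (S := B)
  -- The kernel of the multiplication is pure.
  obtain ⟨s, hs, hsb⟩ : ∃ s : B ⊗[A] B, μ s = 1 ∧ s * (b ⊗ₜ 1) = s * (1 ⊗ₜ b) := by
    have hflat : μ.toRingHom.Flat := Algebra.WeaklyEtale.flat_lmul' A B
    algebraize [μ.toRingHom]
    have hμ : Function.Surjective (Algebra.linearMap (B ⊗[A] B) B) := fun x ↦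
      ⟨x ⊗ₜ 1, by simp [RingHom.algebraMap_toAlgebra, μ]⟩
    have : (RingHom.ker μ.toRingHom).Pure :=
      Module.Flat.of_linearEquiv
        ((Algebra.linearMap (B ⊗[A] B) B).quotKerEquivOfSurjective hμ)
    obtain ⟨y, hy, h⟩ := Ideal.exists_eq_mul_of_pure (I := RingHom.ker μ.toRingHom)
      (x := b ⊗ₜ 1 - 1 ⊗ₜ b) (by simp [RingHom.mem_ker, μ])
    have hy' : μ y = 0 := hy
    exact ⟨1 - y, by simp [hy'], by linear_combination h⟩
  -- Let `s̄ = π s` in `Q ⊗ B`. As `b` dies in `Q`, the relation on `s` gives `s̄(1 ⊗ b) = 0`.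
  -- Flatness of `Q` lifts this vanishing to `Q ⊗ I`, and mapping to `I/I²` turns it into `μ(s)b = b
  -- ∈ I²`.
  let I : Ideal B := Ideal.span {b}
  let Q := B ⧸ I
  have : Module.Flat A Q := flat_of_forall_exists_mul_mul_eq hA Q
  let π : B ⊗[A] B →ₐ[A] Q ⊗[A] B :=
    Algebra.TensorProduct.map (Ideal.Quotient.mkₐ A I) (AlgHom.id A B)
  let c : B →ₗ[A] I :=
    (LinearMap.toSpanSingleton B I ⟨b, Ideal.mem_span_singleton_self b⟩).restrictScalars A
  let ι : I →ₗ[A] B := I.subtype.restrictScalars A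
  have hι : ∀ z : Q ⊗[A] B, ι.lTensor Q (c.lTensor Q z) = z * (1 ⊗ₜ b) := by
    intro z
    induction z with
    | zero => simp
    | tmul u v => simp [ι, c]
    | add u v hu hv => simp only [map_add, hu, hv, add_mul]
  have hinj : Function.Injective (ι.lTensor Q) :=
    Module.Flat.lTensor_preserves_injective_linearMap ι Subtype.val_injective
  have hzero : c.lTensor Q (π s) = 0 := by
    apply hinj
    have hb : Ideal.Quotient.mk I b = 0 :=
      Ideal.Quotient.eq_zero_iff_mem.2 (Ideal.mem_span_singleton_self b)
    have h1 : π (1 ⊗ₜ b) = 1 ⊗ₜ b := by simp [π]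
    have h2 : π (b ⊗ₜ 1) = 0 := by
      change Ideal.Quotient.mk I b ⊗ₜ[A] (1 : B) = 0
      rw [hb, TensorProduct.zero_tmul]
    rw [hι, map_zero, ← h1, ← map_mul, ← hsb, map_mul, h2, mul_zero]
  have : IsScalarTower A Q I.Cotangent := ⟨fun a q x ↦ by
    obtain ⟨q, rfl⟩ := Ideal.Quotient.mk_surjective q
    exact smul_assoc a q x⟩
  have : SMulCommClass Q A I.Cotangent := IsScalarTower.to_smulCommClass' (R := A)
  let φ : Q ⊗[A] I →ₗ[A] I.Cotangent :=
    _root_.TensorProduct.lift (LinearMap.mk₂ A (fun (q : Q) (x : I) ↦ q • I.toCotangent x)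
      (fun _ _ _ ↦ add_smul _ _ _) (fun a q x ↦ smul_assoc a q _)
      (fun _ _ _ ↦ by rw [map_add, smul_add])
      (fun a q x ↦ by
        have : I.toCotangent (a • x) = a • I.toCotangent x := rfl
        rw [this, smul_comm]))
  have hφ : ∀ z : B ⊗[A] B, φ (c.lTensor Q (π z)) =
      I.toCotangent (μ z • ⟨b, Ideal.mem_span_singleton_self b⟩) := by
    intro z
    induction z with
    | zero => simp
    | tmul u v =>
      simp only [φ, π, c, μ, Algebra.TensorProduct.map_tmul, LinearMap.lTensor_tmul,
        Algebra.TensorProduct.lmul'_apply_tmul, mul_smul, map_smul]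
      rfl
    | add u v hu hv => simp only [map_add, hu, hv, add_smul]
  have := hφ s
  rwa [hzero, map_zero, hs, one_smul, eq_comm, Ideal.toCotangent_eq_zero] at this

lemma Algebra.WeaklyEtale.isReduced (hA : ∀ a : A, ∃ x, a * a * x = a)
    (B : Type*) [CommRing B] [Algebra A B] [Algebra.WeaklyEtale A B] : IsReduced B := by
  refine (isReduced_iff_pow_one_lt 2 one_lt_two).2 fun b hb ↦ ?_
  simpa [Ideal.span_singleton_pow, hb] using mem_sq_span_singleton hA b

end VonNeumannRegular

/-- The two inclusions `T → T ⊗ T` agree on `R`, hence coincide. -/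
lemma IsCommRingEpi.isEpi {R T : Type*} [CommRing R] [CommRing T] [Algebra R T]
    (h : IsCommRingEpi (algebraMap R T)) : Algebra.IsEpi R T := by
  rw [Algebra.isEpi_iff_forall_one_tmul_eq]
  intro t
  have := h (T ⊗[R] T) (Algebra.TensorProduct.includeRight (R := R) (A := T)).toRingHom
    Algebra.TensorProduct.includeLeftRingHom
    (by ext r; exact ((Algebra.TensorProduct.includeRight (R := R) (A := T) (B := T)).commutes r))
  exact RingHom.congr_fun this t

/-- For an epimorphism the codiagonal is bijective, hence flat. -/
lemma Algebra.WeaklyEtale.of_flat_of_isEpi (R T : Type*) [CommRing R] [CommRing T] [Algebra R T]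
    [Module.Flat R T] [Algebra.IsEpi R T] : Algebra.WeaklyEtale R T where
  flat_lmul' := by
    apply RingHom.Flat.of_bijective
    refine ⟨?_, fun x ↦ ⟨x ⊗ₜ 1, by simp⟩⟩
    exact Algebra.IsEpi.injective_lift_mul (R := R) (A := T)

lemma Algebra.WeaklyEtale.isRadical_map {R T : Type*} [CommRing R] [CommRing T] [Algebra R T]
    [Algebra.WeaklyEtale R T] {I : Ideal R} (hI : I.IsRadical) :
    (I.map (algebraMap R T)).IsRadical := by
  -- A von Neumann regular `R`-algebra in which the kernel of the structure map is `I`.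
  let A := ∀ p : PrimeSpectrum.zeroLocus (I : Set R), p.1.asIdeal.ResidueField
  have hA : ∀ a : A, ∃ x, a * a * x = a := fun a ↦
    ⟨fun p ↦ (a p)⁻¹, funext fun p ↦ mul_self_mul_inv (a p)⟩
  have hann : (Submodule.span R {(1 : A)}).annihilator = I := by
    have hI' : PrimeSpectrum.vanishingIdeal (PrimeSpectrum.zeroLocus (I : Set R)) = I := by
      rw [PrimeSpectrum.vanishingIdeal_zeroLocus_eq_radical, hI.radical]
    refine Eq.trans ?_ hI'
    ext a
    rw [Submodule.mem_annihilator_span_singleton, PrimeSpectrum.mem_vanishingIdeal,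
      ← Algebra.algebraMap_eq_smul_one, funext_iff]
    simp [A]
  -- The kernel of `T → A ⊗ T` is the annihilator of `1 ⊗ 1`, which by flatness is the extension of
  -- `Ann_R(1) = I`.
  have hmem (t : T) : t ∈ I.map (algebraMap R T) ↔
      Algebra.TensorProduct.includeRight (R := R) (A := A) t = 0 := by
    have h : I.map (algebraMap R T) = (Submodule.span T {(1 : T) ⊗ₜ[R] (1 : A)}).annihilator := by
      rw [annihilator_span_one_tmul]
      exact congrArg _ hann.symm
    rw [← (TensorProduct.comm R A T).map_eq_zero_iff, h,
      Submodule.mem_annihilator_span_singleton, TensorProduct.smul_tmul', smul_eq_mul, mul_one]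
    rfl
  have := Algebra.WeaklyEtale.isReduced hA (A ⊗[R] T)
  rintro t ⟨n, hn⟩
  rw [hmem] at hn ⊢
  rw [map_pow] at hn
  exact eq_zero_of_pow_eq_zero hn

theorem mainTheorem4 {R T E : Type*} [CommRing R] [CommRing T] [Algebra R T]
    [AddCommGroup E] [Module R E] (hflat : Module.Flat R T) :
    -- the preimage of the support under the spectral map is the support of the base change
    PrimeSpectrum.comap (algebraMap R T) ⁻¹' Module.support R E = Module.support T (T ⊗[R] E) ∧
    -- closed support
    (IsClosed (Module.support R E) →
      IsClosed (Module.support T (T ⊗[R] E)) ∧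
      odaIdeal T (T ⊗[R] E) = ((odaIdeal R E).map (algebraMap R T)).radical) ∧
    -- closed support and absolutely flat morphism
    (IsClosed (Module.support R E) → Algebra.WeaklyEtale R T →
      odaIdeal T (T ⊗[R] E) = (odaIdeal R E).map (algebraMap R T)) ∧
    -- flat epimorphisms are absolutely flat, so that the last equality holds for them
    (IsCommRingEpi (algebraMap R T) →
      Algebra.WeaklyEtale R T ∧
      (IsClosed (Module.support R E) →
        odaIdeal T (T ⊗[R] E) = (odaIdeal R E).map (algebraMap R T))) := by
  have h3 (h : IsClosed (Module.support R E)) (_ : Algebra.WeaklyEtale R T) :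
      odaIdeal T (T ⊗[R] E) = (odaIdeal R E).map (algebraMap R T) := by
    rw [odaIdeal_tensorProduct_eq_radical h]
    exact (Algebra.WeaklyEtale.isRadical_map (isRadical_odaIdeal R E)).radical
  refine ⟨comap_preimage_support_eq_support_tensorProduct R T E,
    fun h ↦ ⟨?_, odaIdeal_tensorProduct_eq_radical h⟩, h3, fun he ↦ ?_⟩
  · rw [← comap_preimage_support_eq_support_tensorProduct]
    exact h.preimage (PrimeSpectrum.continuous_comap _)
  · have := he.isEpi
    have hw := Algebra.WeaklyEtale.of_flat_of_isEpi R T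
    exact ⟨hw, fun h ↦ h3 h hw⟩
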